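/- Let $\mathcal A$ be a unital $C^*$-algebra and let $H_{\mathcal A}$ be the standard Hilbert $\mathcal A$-module, i.e. the module of all sequences $x=(x_k)_{k\in\mathbb N}$ in $\mathcal A$ for which $\sum_k x_kx_k^*$ converges in norm, with $\mathcal A$ acting coordinatewise by left multiplication, $\langle x,y\rangle=\sum_k y_kx_k^*$ and $\|x\|=\|\langle x,x\rangle\|^{1/2}$. (The version for right modules is the same statement for the opposite algebra.) Let $B^a(H_{\mathcal A})$ be the set of bounded adjointable operators on $H_{\mathcal A}$, and let $K(H_{\mathcal A})$ be the compact operators, i.e. the operator-norm closure of the linear span of the operators $z\mapsto\langle y,z\rangle x$, $x,y\in H_{\mathcal A}$. Let ${\mathcal M\Phi_+^-}'(H_{\mathcal A})$ be the set of all $F\in B^a(H_{\mathcal A})$ for which there are closed submodules $M_1,N_1,M_2,N_2$ of $H_{\mathcal A}$ such that - $H_{\mathcal A}=M_1\,\tilde\oplus\, N_1=M_2\,\tilde\oplus\, N_2$ (direct sums, not necessarily orthogonal); - $F(M_1)\subseteq M_2$, $F(N_1)\subseteq N_2$, and $F|_{M_1}:M_1\to M_2$ is an isomorphism; - $N_1$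 is finitely generated; - $N_1$ is isomorphic to a closed submodule of $N_2$. Here an isomorphism is a bounded $\mathcal A$-linear bijection with bounded inverse, and a submodule is finitely generated if it is the $\mathcal A$-linear span of finitely many of its elements. **Theorem.** For $F\in B^a(H_{\mathcal A})$ the following are equivalent: 1. $F\in{\mathcal M\Phi_+^-}'(H_{\mathcal A})$; 2. there exist $D\in B^a(H_{\mathcal A})$ and $K\in K(H_{\mathcal A})$ such that $D$ is bounded below (there is $c>0$ with $\|Dx\|\ge c\|x\|$ for all $x$) and $F=D+K$. -/

import Mathlib

open scoped ComplexOrder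

section StandardModule

variable {A : Type*} [CStarAlgebra A]

theorem summable_mul_star_smul (a : A) {x : ℕ → A}
    (hx : Summable fun k => x k * star (x k)) :
    Summable fun k => (a * x k) * star (a * x k) := by
  have h := (hx.mul_left a).mul_right (star a)
  refine h.congr fun k => ?_
  simp [mul_assoc]

variable [PartialOrder A] [StarOrderedRing A]

/-- Comparison test for series of positive elements of a `C⋆`-algebra. -/
theorem summable_of_nonneg_of_le_cstar {ι : Type*} {f g : ι → A} (hf : ∀ i, 0 ≤ f i)
    (hfg : ∀ i, f i ≤ g i) (hg : Summable g) : Summable f := by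
  rw [summable_iff_vanishing_norm] at hg ⊢
  intro ε hε
  obtain ⟨s, hs⟩ := hg ε hε
  refine ⟨s, fun t ht => lt_of_le_of_lt ?_ (hs t ht)⟩
  exact CStarAlgebra.norm_le_norm_of_nonneg_of_le (Finset.sum_nonneg fun i _ => hf i)
    (Finset.sum_le_sum fun i _ => hfg i)

theorem summable_add_mul_star {x y : ℕ → A} (hx : Summable fun k => x k * star (x k))
    (hy : Summable fun k => y k * star (y k)) :
    Summable fun k => (x k + y k) * star (x k + y k) := by
  refine summable_of_nonneg_of_le_cstar (fun k => mul_star_self_nonneg _) (fun k => ?_)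
    ((hx.add hy).add (hx.add hy))
  have h : 0 ≤ (x k - y k) * star (x k - y k) := mul_star_self_nonneg _
  rw [← sub_nonneg]
  convert h using 1
  simp only [star_add, star_sub]
  noncomm_ring

variable (A) in
/-- The sequences `x` in `A` for which `∑ x k * star (x k)` converges in norm. (The terms are
positive, so unconditional convergence is the same as convergence of the partial sums.) -/
def stdSubmodule : Submodule A (ℕ → A) where
  carrier := {x | Summable fun k => x k * star (x k)}
  add_mem' hx hy := summable_add_mul_star hx hy
  zero_mem' := by simp
  smul_mem' a _ hx := summable_mul_star_smul a hx

variable (A) in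
/-- The standard Hilbert module `H_A` over `A`. As in Mathlib's `CStarModule`, the algebra acts on
the left and the inner product is `A`-linear in its second variable. The type is not reducible to a
subtype of `ℕ → A`, so that it does not inherit the product topology. -/
def StdModule : Type _ := stdSubmodule A

namespace StdModule

noncomputable instance : AddCommGroup (StdModule A) := inferInstanceAs (AddCommGroup (stdSubmodule A))

noncomputable instance : Module A (StdModule A) := inferInstanceAs (Module A (stdSubmodule A))

noncomputable instance : Module ℂ (StdModule A) := inferInstanceAs (Module ℂ (stdSubmodule A))

instance : IsScalarTower ℂ A (StdModule A) :=
  inferInstanceAs (IsScalarTower ℂ A (stdSubmodule A))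

/-- The `k`-th coordinate of an element of `H_A`. -/
def coord (x : StdModule A) (k : ℕ) : A := x.1 k

@[ext]
theorem ext {x y : StdModule A} (h : ∀ k, x.coord k = y.coord k) : x = y :=
  Subtype.ext (funext h)

@[simp] theorem coord_add (x y : StdModule A) (k : ℕ) :
    (x + y).coord k = x.coord k + y.coord k := rfl

@[simp] theorem coord_zero (k : ℕ) : (0 : StdModule A).coord k = 0 := rfl

@[simp] theorem coord_smul (a : A) (x : StdModule A) (k : ℕ) :
    (a • x).coord k = a * x.coord k := rfl

@[simp] theorem coord_smul_complex (z : ℂ) (x : StdModule A) (k : ℕ) :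
    (z • x).coord k = z • x.coord k := rfl

theorem summable_self (x : StdModule A) : Summable fun k => x.coord k * star (x.coord k) := x.2

theorem summable_inner (x y : StdModule A) : Summable fun k => y.coord k * star (x.coord k) := by
  have h1 := ((y + x).summable_self.sub y.summable_self).sub x.summable_self
  have h2 := ((y + Complex.I • x).summable_self.sub y.summable_self).sub x.summable_self
  refine ((h1.add (h2.const_smul Complex.I)).const_smul (1 / 2 : ℂ)).congr fun k => ?_
  simp only [coord_add, coord_smul_complex, star_add, star_smul, add_mul, mul_add,
    smul_mul_assoc, mul_smul_comm, smul_add, smul_sub, smul_smul]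
  simp only [RCLike.star_def, Complex.conj_I]
  match_scalars <;> norm_num

/-- `⟪x, y⟫ = ∑ y k * star (x k)`, and `‖x‖ = ‖⟪x, x⟫‖ ^ (1/2)`. -/
noncomputable instance : Inner A (StdModule A) where
  inner x y := ∑' k, y.coord k * star (x.coord k)

theorem inner_def (x y : StdModule A) :
    inner A x y = ∑' k, y.coord k * star (x.coord k) := rfl

noncomputable instance : Norm (StdModule A) := CStarModule.norm A

noncomputable instance : CStarModule A (StdModule A) where
  inner_add_right {x y z} := by
    simp only [inner_def, coord_add, add_mul]
    exact (summable_inner x y).tsum_add (summable_inner x z)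
  inner_self_nonneg {x} := tsum_nonneg fun k => mul_star_self_nonneg _
  inner_self {x} := by
    constructor
    · intro h
      have h0 : HasSum (fun k => x.coord k * star (x.coord k)) 0 := by
        have := x.summable_self.hasSum
        rwa [← inner_def, h] at this
      rw [hasSum_zero_iff_of_nonneg fun k => mul_star_self_nonneg _] at h0
      ext k
      exact (CStarRing.mul_star_self_eq_zero_iff _).1 (congrFun h0 k)
    · rintro rfl
      simp [inner_def]
  inner_op_smul_right {a x y} := by
    simp only [inner_def, coord_smul, mul_assoc]
    exact (summable_inner x y).tsum_mul_left a
  inner_smul_right_complex {z x y} := by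
    simp only [inner_def, coord_smul_complex, smul_mul_assoc]
    exact (summable_inner x y).tsum_const_smul z
  star_inner x y := by
    simp only [inner_def, tsum_star, star_mul, star_star]
  norm_eq_sqrt_norm_inner_self _ := rfl

noncomputable instance : NormedAddCommGroup (StdModule A) := CStarModule.normedAddCommGroup A

noncomputable instance : NormedSpace ℂ (StdModule A) := .ofCore (CStarModule.normedSpaceCore A)

end StdModule

end StandardModule

section Operators

variable (A : Type*) [CStarAlgebra A] [PartialOrder A] [StarOrderedRing A]
variable {E : Type*} [NormedAddCommGroup E] [NormedSpace ℂ E] [Module A E] [CStarModule A E]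

/-- The set `B^a(E)` of bounded adjointable operators on `E`; such operators are automatically
`A`-linear. -/
def adjointableOperators : Set (E →L[ℂ] E) :=
  {F | ∃ G : E →L[ℂ] E, ∀ x y : E, inner A (F x) y = inner A x (G y)}

/-- Bounded below. -/
def IsBoundedBelowOp (D : E →L[ℂ] E) : Prop :=
  ∃ c : ℝ, 0 < c ∧ ∀ x : E, c * ‖x‖ ≤ ‖D x‖

theorem norm_smul_le_cstarModule (a : A) (x : E) : ‖a • x‖ ≤ ‖a‖ * ‖x‖ := by
  rw [← pow_le_pow_iff_left₀ (norm_nonneg _) (by positivity) two_ne_zero, mul_pow,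
    CStarModule.norm_sq_eq A (x := a • x), CStarModule.norm_sq_eq A (x := x),
    CStarModule.inner_op_smul_right,
    CStarModule.inner_op_smul_left]
  calc ‖a * (inner A x x * star a)‖ ≤ ‖a‖ * (‖inner A x x‖ * ‖star a‖) :=
        (norm_mul_le _ _).trans (by gcongr; exact norm_mul_le _ _)
    _ = ‖a‖ ^ 2 * ‖inner A x x‖ := by rw [norm_star]; ring

/-- The elementary operator `θ_{x,y} : z ↦ ⟪y, z⟫ x`. -/
noncomputable def elementaryOperator [IsScalarTower ℂ A E] (x y : E) : E →L[ℂ] E :=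
  LinearMap.mkContinuous
    { toFun := fun z => inner A y z • x
      map_add' := fun z w => by rw [CStarModule.inner_add_right, add_smul]
      map_smul' := fun c z => by
        rw [CStarModule.inner_smul_right_complex, smul_assoc, RingHom.id_apply] }
    (‖y‖ * ‖x‖) fun z => by
      refine (norm_smul_le_cstarModule A (inner A y z) x).trans ?_
      calc ‖inner A y z‖ * ‖x‖ ≤ (‖y‖ * ‖z‖) * ‖x‖ := by
            gcongr
            exact CStarModule.norm_inner_le E
        _ = ‖y‖ * ‖x‖ * ‖z‖ := by ring

/-- The compact operators `K(E)` in the sense of Hilbert `C⋆`-modules: the operator norm closure of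
the linear span of the elementary operators. -/
noncomputable def compactOperators (E : Type*) [NormedAddCommGroup E] [NormedSpace ℂ E]
    [Module A E] [CStarModule A E] [IsScalarTower ℂ A E] : Submodule ℂ (E →L[ℂ] E) :=
  (Submodule.span ℂ
    (Set.range fun p : E × E => elementaryOperator A p.1 p.2)).topologicalClosure

variable {A}

/-- `N ≼ N'`: `N` is isomorphic (by a bounded `A`-linear map with bounded inverse) to a closed
submodule of `N'`. -/
def IsEmbeddable (N N' : Submodule A E) : Prop :=
  ∃ P : Submodule A E, P ≤ N' ∧ IsClosed (P : Set E) ∧ Nonempty (N ≃L[A] P)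

/-- `E = M ⊕ N` (algebraically direct, not necessarily orthogonal) with closed submodules. -/
def IsClosedDecomposition (M N : Submodule A E) : Prop :=
  IsClosed (M : Set E) ∧ IsClosed (N : Set E) ∧ IsCompl M N

/-- With respect to `E = M₁ ⊕ N₁ → M₂ ⊕ N₂ = E` the operator `F` is diagonal, and its first entry
`F₁ : M₁ → M₂` is an isomorphism. -/
def IsDiagonalWithIso (F : E →L[ℂ] E) (M₁ N₁ M₂ N₂ : Submodule A E) : Prop :=
  (∃ F₁ : M₁ ≃L[A] M₂, ∀ x : M₁, F x = F₁ x) ∧ ∀ x ∈ N₁, F x ∈ N₂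

variable (A)

/-- The class `MΦ₊⁻′(E)`. -/
def mPhiPlusMinusPrime : Set (E →L[ℂ] E) :=
  {F | F ∈ adjointableOperators A ∧ ∃ M₁ N₁ M₂ N₂ : Submodule A E,
    IsClosedDecomposition M₁ N₁ ∧ IsClosedDecomposition M₂ N₂ ∧
    IsDiagonalWithIso F M₁ N₁ M₂ N₂ ∧ N₁.FG ∧ IsEmbeddable N₁ N₂}

end Operators

/-!
If `F = D + K` with `D` bounded below and `K` compact, then `K (1 - p)` is small for a projection
`p` onto sufficiently many coordinates, so `D₁ = D + K (1 - p)` is still bounded below. An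
adjointable operator `D₁` which is bounded below has an `A`-linear left inverse `L`: the positive
operator `T = D₁⋆ D₁` is bounded below, and this bound persists along the path `T + t`, which
connects `T` to invertible operators. As `F` and `D₁` agree on the kernel of `p`, the operator
`Q = (1 - p) L` is a generalized inverse of `F`, i.e. `Q F Q = Q`, and the idempotents `Q F` and
`F Q` give the required decompositions.

Conversely, a finitely generated closed submodule `N₁` is the range of a finite rank retraction `R`,
because its synthesis operator `Aⁿ → N₁` is surjective and so its adjoint has a left inverse.
Replacing `F` on `N₁` by an embedding `e : N₁ → N₂` gives the operator `F (1 - R) + e R`, which is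
bounded below and differs from `F` by the finite rank operator `(F - e) R`.
-/

open Filter Topology

section BanachSpace

variable {𝕜 X : Type*} [NormedAddCommGroup X] [CompleteSpace X]

theorem isUnit_of_norm_sub_lt [NontriviallyNormedField 𝕜] [NormedSpace 𝕜 X] {S T : X →L[𝕜] X}
    {c : ℝ} (hS : IsUnit S) (hc : ∀ x, c * ‖x‖ ≤ ‖S x‖) (hST : ‖S - T‖ < c) : IsUnit T := by
  obtain ⟨u, rfl⟩ := hS
  have hc₀ : 0 < c := (norm_nonneg _).trans_lt hST
  set U : X →L[𝕜] X := ↑u⁻¹ with hU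
  have hinv : ‖U‖ ≤ c⁻¹ := by
    refine ContinuousLinearMap.opNorm_le_bound _ (by positivity) fun x => ?_
    rw [inv_mul_eq_div, le_div_iff₀' hc₀]
    simpa only [hU, ← mul_apply_eq_comp, Units.mul_inv,
      one_apply_eq_self] using hc (U x)
  have hlt : ‖U * (u - T)‖ < 1 :=
    calc ‖U * (u - T)‖ ≤ c⁻¹ * ‖↑u - T‖ := (norm_mul_le _ _).trans (by gcongr)
      _ < c⁻¹ * c := by gcongr
      _ = 1 := inv_mul_cancel₀ hc₀.ne'
  have hT : T = u * (1 - U * (u - T)) := by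
    rw [mul_sub, mul_one, ← mul_assoc, hU, Units.mul_inv, one_mul, sub_sub_cancel]
  rw [hT]
  exact u.isUnit.mul (isUnit_one_sub_of_norm_lt_one hlt)

theorem isUnit_of_forall_nonneg_le_norm_add_smul [RCLike 𝕜] [NormedSpace 𝕜 X] {T : X →L[𝕜] X}
    {c : ℝ} (hc : 0 < c) (hT : ∀ t : ℝ, 0 ≤ t → ∀ x, c * ‖x‖ ≤ ‖T x + (t : 𝕜) • x‖) :
    IsUnit T := by
  set S : ℕ → X →L[𝕜] X := fun n => T + ((n * (c / 2) : ℝ) : 𝕜) • 1 with hS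
  have hle (n : ℕ) (x : X) : c * ‖x‖ ≤ ‖S n x‖ := hT _ (by positivity) x
  have hdescend (n : ℕ) (h : IsUnit (S (n + 1))) : IsUnit (S n) := by
    refine isUnit_of_norm_sub_lt h (hle _) ?_
    have hsub : S (n + 1) - S n = ((c / 2 : ℝ) : 𝕜) • 1 := by
      simp only [hS, add_sub_add_left_eq_sub, ← sub_smul, ← RCLike.ofReal_sub]
      congr 2
      push_cast
      ring
    calc ‖S (n + 1) - S n‖ ≤ ‖((c / 2 : ℝ) : 𝕜)‖ * 1 := by
          rw [hsub, norm_smul]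
          gcongr
          exact ContinuousLinearMap.norm_id_le
      _ = c / 2 := by rw [mul_one, RCLike.norm_of_nonneg (by positivity)]
      _ < c := half_lt_self hc
  obtain ⟨n, hn⟩ : ∃ n : ℕ, ‖-T‖ * ‖(1 : X →L[𝕜] X)‖ < n * (c / 2) := by
    obtain ⟨n, hn⟩ := exists_nat_gt (‖-T‖ * ‖(1 : X →L[𝕜] X)‖ / (c / 2))
    exact ⟨n, (div_lt_iff₀ (half_pos hc)).1 hn⟩
  have hunit : IsUnit (S n) := by
    have hres := spectrum.mem_resolventSet_of_norm_lt_mul (𝕜 := 𝕜) (a := -T)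
      (k := ((n * (c / 2) : ℝ) : 𝕜)) (by rwa [RCLike.norm_of_nonneg (by positivity)])
    rwa [spectrum.mem_resolventSet_iff, Algebra.algebraMap_eq_smul_one, sub_neg_eq_add,
      add_comm] at hres
  have hzero : IsUnit (S 0) :=
    Nat.decreasingInduction (motive := fun k _ => IsUnit (S k)) (fun k _ => hdescend k) hunit
      n.zero_le
  simpa [hS] using hzero

end BanachSpace

section Adjoint

variable {A : Type*} [CStarAlgebra A] [PartialOrder A]
variable {E E' : Type*}
  [NormedAddCommGroup E] [NormedSpace ℂ E] [Module A E] [CStarModule A E]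
  [NormedAddCommGroup E'] [NormedSpace ℂ E'] [Module A E'] [CStarModule A E']

variable (A) in
/-- The maps `F` and `G` between Hilbert modules are adjoint to each other: `⟪F x, y⟫ = ⟪x, G y⟫`.
They are plain functions so that the notion applies to maps that are linear over `ℂ` or over `A`. -/
def IsInnerAdjoint (F : E → E') (G : E' → E) : Prop :=
  ∀ x y, inner A (F x) y = inner A x (G y)

theorem eq_of_forall_inner_eq {x y : E} (h : ∀ z, inner A x z = inner A y z) : x = y := by
  rw [← sub_eq_zero, ← CStarModule.inner_self (A := A), CStarModule.inner_sub_left, h, sub_self]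

theorem norm_le_norm_of_inner_self_le [StarOrderedRing A] {x : E} {y : E'}
    (h : inner A x x ≤ inner A y y) : ‖x‖ ≤ ‖y‖ := by
  rw [← pow_le_pow_iff_left₀ (norm_nonneg _) (norm_nonneg _) two_ne_zero,
    CStarModule.norm_sq_eq A, CStarModule.norm_sq_eq A]
  exact CStarAlgebra.norm_le_norm_of_nonneg_of_le CStarModule.inner_self_nonneg h

theorem norm_le_norm_add_smul_of_nonneg [StarOrderedRing A] {x y : E} (h : 0 ≤ inner A x y) {t : ℝ}
    (ht : 0 ≤ t) : ‖y‖ ≤ ‖y + (t : ℂ) • x‖ := by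
  have hcomm : inner A y x = inner A x y := by
    rw [← CStarModule.star_inner, (IsSelfAdjoint.of_nonneg h).star_eq]
  have ht' : (0 : ℂ) ≤ t := by exact_mod_cast ht
  refine norm_le_norm_of_inner_self_le (A := A) ?_
  simp only [CStarModule.inner_add_left, CStarModule.inner_add_right,
    CStarModule.inner_smul_right_complex, CStarModule.inner_smul_left_complex, hcomm,
    RCLike.star_def, Complex.conj_ofReal, add_assoc]
  exact le_add_of_nonneg_right (add_nonneg (smul_nonneg ht' h) (smul_nonneg ht'
    (add_nonneg h (smul_nonneg ht' CStarModule.inner_self_nonneg))))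

theorem le_of_sq_le_mul {a b : ℝ} (hb : 0 ≤ b) (h : a ^ 2 ≤ b * a) : a ≤ b := by
  by_contra! hlt
  nlinarith

namespace IsInnerAdjoint

variable {F : E → E'} {G : E' → E}

theorem symm (h : IsInnerAdjoint A F G) : IsInnerAdjoint A G F := fun y x => by
  rw [← CStarModule.star_inner, ← h, CStarModule.star_inner]

theorem comp {E'' : Type*} [NormedAddCommGroup E''] [NormedSpace ℂ E''] [Module A E'']
    [CStarModule A E''] {F' : E' → E''} {G' : E'' → E'} (h' : IsInnerAdjoint A F' G')
    (h : IsInnerAdjoint A F G) : IsInnerAdjoint A (F' ∘ F) (G ∘ G') := fun x y =>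
  (h' _ y).trans (h x _)

theorem map_smul (h : IsInnerAdjoint A F G) (a : A) (x : E) : F (a • x) = a • F x :=
  eq_of_forall_inner_eq (A := A) fun z => by
    rw [h, CStarModule.inner_op_smul_left, CStarModule.inner_op_smul_left, h]

/-- An operator with an adjoint, regarded as an `A`-linear operator. -/
def toCLM {F : E →L[ℂ] E'} (h : IsInnerAdjoint A F G) : E →L[A] E' where
  toFun := F
  map_add' := map_add F
  map_smul' := h.map_smul
  cont := F.continuous

theorem of_rightInverse {T U : E → E} (hT : IsInnerAdjoint A T T)
    (hU : Function.RightInverse U T) : IsInnerAdjoint A U U := fun x y => by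
  rw [← hU y, ← hT, hU, hU]

theorem norm_sub_apply_sq_of_idempotent {p : E → E} (h : IsInnerAdjoint A p p)
    (hp : ∀ x, p (p x) = p x) (x : E) : ‖x - p x‖ ^ 2 = ‖inner A x x - inner A (p x) x‖ := by
  have hpx : inner A (p x) (p x) = inner A (p x) x := by rw [← h, hp]
  rw [CStarModule.norm_sq_eq A, CStarModule.inner_sub_left, CStarModule.inner_sub_right,
    CStarModule.inner_sub_right, ← h, hpx, sub_self, sub_zero]

variable [StarOrderedRing A]

theorem norm_apply_sq_le (h : IsInnerAdjoint A F G) (x : E) : ‖F x‖ ^ 2 ≤ ‖x‖ * ‖G (F x)‖ := by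
  rw [CStarModule.norm_sq_eq A, h]
  exact CStarModule.norm_inner_le E

theorem norm_apply_le_of_idempotent {p : E → E} (h : IsInnerAdjoint A p p)
    (hp : ∀ x, p (p x) = p x) (x : E) : ‖p x‖ ≤ ‖x‖ :=
  le_of_sq_le_mul (norm_nonneg x) (by simpa only [hp] using h.norm_apply_sq_le x)

theorem opNorm_le {F : E →L[ℂ] E'} {G : E' →L[ℂ] E} (h : IsInnerAdjoint A F G) : ‖F‖ ≤ ‖G‖ :=
  F.opNorm_le_bound (norm_nonneg _) fun x => le_of_sq_le_mul (by positivity) <|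
    calc ‖F x‖ ^ 2 ≤ ‖x‖ * ‖G (F x)‖ := h.norm_apply_sq_le x
      _ ≤ ‖x‖ * (‖G‖ * ‖F x‖) := by gcongr; exact G.le_opNorm _
      _ = ‖G‖ * ‖x‖ * ‖F x‖ := by ring

theorem exists_leftInverse [CompleteSpace E] {F : E →L[ℂ] E'} {G : E' →L[ℂ] E}
    (h : IsInnerAdjoint A F G) {c : ℝ} (hc : 0 < c) (hF : ∀ x, c * ‖x‖ ≤ ‖F x‖) :
    ∃ L : E' →L[A] E, ∀ x, L (F x) = x := by
  set T : E →L[ℂ] E := G ∘L F with hT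
  have hsymm : IsInnerAdjoint A T T := h.symm.comp h
  have hpos (x : E) : 0 ≤ inner A x (T x) := by
    rw [hT, ContinuousLinearMap.comp_apply, ← h]
    exact CStarModule.inner_self_nonneg
  have hbelow (x : E) : c ^ 2 * ‖x‖ ≤ ‖T x‖ := le_of_sq_le_mul (norm_nonneg _) <|
    calc (c ^ 2 * ‖x‖) ^ 2 = c ^ 2 * (c * ‖x‖) ^ 2 := by ring
      _ ≤ c ^ 2 * ‖F x‖ ^ 2 := by gcongr; exact hF x
      _ ≤ c ^ 2 * (‖x‖ * ‖T x‖) := by gcongr; exact h.norm_apply_sq_le x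
      _ = ‖T x‖ * (c ^ 2 * ‖x‖) := by ring
  obtain ⟨u, hu⟩ : IsUnit T :=
    isUnit_of_forall_nonneg_le_norm_add_smul (𝕜 := ℂ) (pow_pos hc 2) fun t ht x =>
      (hbelow x).trans (norm_le_norm_add_smul_of_nonneg (hpos x) ht)
  set U : E →L[ℂ] E := ↑u⁻¹ with hU
  have hUT (x : E) : U (T x) = x := by rw [← mul_apply_eq_comp, ← hu, hU, u.inv_mul]; rfl
  have hTU (x : E) : T (U x) = x := by rw [← mul_apply_eq_comp, ← hu, hU, u.mul_inv]; rfl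
  have hL : IsInnerAdjoint A (U ∘L G) (F ∘L U) :=
    (hsymm.of_rightInverse hTU).comp h.symm
  exact ⟨hL.toCLM, hUT⟩

theorem exists_norm_le_of_surjective [CompleteSpace E] [CompleteSpace E'] {F : E →L[ℂ] E'}
    (h : IsInnerAdjoint A F G) (hF : Function.Surjective F) :
    ∃ c : ℝ, 0 < c ∧ ∀ y, c * ‖y‖ ≤ ‖G y‖ := by
  obtain ⟨C, hC, hpre⟩ := F.exists_preimage_norm_le hF
  refine ⟨C⁻¹, inv_pos.2 hC, fun y => ?_⟩
  obtain ⟨x, rfl, hx⟩ := hpre y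
  rw [inv_mul_le_iff₀ hC]
  exact le_of_sq_le_mul (by positivity) <|
    calc ‖F x‖ ^ 2 ≤ ‖x‖ * ‖G (F x)‖ := h.norm_apply_sq_le x
      _ ≤ C * ‖F x‖ * ‖G (F x)‖ := by gcongr
      _ = C * ‖G (F x)‖ * ‖F x‖ := by ring

end IsInnerAdjoint

theorem exists_leftInverse_of_mem_adjointableOperators [StarOrderedRing A] [CompleteSpace E]
    {D : E →L[ℂ] E} (hD : D ∈ adjointableOperators A) (hDb : IsBoundedBelowOp D) :
    ∃ L : E →L[A] E, ∀ x, L (D x) = x := by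
  obtain ⟨D', hD'⟩ := hD
  obtain ⟨c, hc, hle⟩ := hDb
  exact IsInnerAdjoint.exists_leftInverse hD' hc hle

end Adjoint

section AdjointableOperators

variable (A : Type*) [CStarAlgebra A] [PartialOrder A]
variable (E : Type*) [NormedAddCommGroup E] [NormedSpace ℂ E] [Module A E] [CStarModule A E]

/-- The adjointable operators as a subalgebra of the bounded operators. -/
def adjointableSubalgebra : Subalgebra ℂ (E →L[ℂ] E) where
  carrier := adjointableOperators A
  mul_mem' := by
    rintro F₁ F₂ ⟨G₁, h₁⟩ ⟨G₂, h₂⟩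
    exact ⟨G₂ * G₁, fun x y => by simp only [mul_apply_eq_comp, h₁, h₂]⟩
  add_mem' := by
    rintro F₁ F₂ ⟨G₁, h₁⟩ ⟨G₂, h₂⟩
    refine ⟨G₁ + G₂, fun x y => ?_⟩
    simp only [add_apply, CStarModule.inner_add_left, CStarModule.inner_add_right, h₁, h₂]
  algebraMap_mem' c := by
    refine ⟨algebraMap ℂ _ (star c), fun x y => ?_⟩
    simp only [ContinuousLinearMap.algebraMap_apply, CStarModule.inner_smul_left_complex,
      CStarModule.inner_smul_right_complex]

theorem isClosed_adjointableSubalgebra [StarOrderedRing A] [CompleteSpace E] :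
    IsClosed (adjointableSubalgebra A E : Set (E →L[ℂ] E)) := by
  refine isClosed_of_closure_subset fun F hF => ?_
  obtain ⟨u, hu, huF⟩ := mem_closure_iff_seq_limit.1 hF
  choose v hv using hu
  have hle (m n : ℕ) : dist (v m) (v n) ≤ dist (u m) (u n) := by
    rw [dist_eq_norm, dist_eq_norm]
    refine IsInnerAdjoint.opNorm_le (A := A) (IsInnerAdjoint.symm fun x y => ?_)
    simp only [sub_apply, CStarModule.inner_sub_left, CStarModule.inner_sub_right, hv m x, hv n x]
  have hv_cauchy : CauchySeq v := Metric.cauchySeq_iff.2 fun ε hε =>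
    (Metric.cauchySeq_iff.1 huF.cauchySeq ε hε).imp fun N hN m hm n hn =>
      (hle m n).trans_lt (hN m hm n hn)
  obtain ⟨G, hG⟩ := cauchySeq_tendsto_of_complete hv_cauchy
  refine ⟨G, fun x y => ?_⟩
  have hFx : Tendsto (fun n => inner A (u n x) y) atTop (𝓝 (inner A (F x) y)) :=
    CStarModule.continuous_inner.tendsto _ |>.comp
      (((ContinuousLinearMap.apply ℂ E x).continuous.tendsto F |>.comp huF).prodMk_nhds
        tendsto_const_nhds)
  have hGy : Tendsto (fun n => inner A x (v n y)) atTop (𝓝 (inner A x (G y))) :=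
    CStarModule.continuous_inner.tendsto _ |>.comp (tendsto_const_nhds.prodMk_nhds
      ((ContinuousLinearMap.apply ℂ E y).continuous.tendsto G |>.comp hG))
  exact tendsto_nhds_unique hFx (hGy.congr fun n => (hv n x y).symm)

variable [StarOrderedRing A] [IsScalarTower ℂ A E]

/-- The operators of finite rank in the sense of Hilbert modules, i.e. the span of the elementary
operators; their norm closure is `compactOperators A E`. -/
def finiteRankOperators : Submodule ℂ (E →L[ℂ] E) :=
  Submodule.span ℂ (Set.range fun p : E × E => elementaryOperator A p.1 p.2)

variable {A E}

theorem elementaryOperator_apply (x y z : E) :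
    elementaryOperator A x y z = inner A y z • x := rfl

theorem isInnerAdjoint_elementaryOperator (x y : E) :
    IsInnerAdjoint A (elementaryOperator A x y) (elementaryOperator A y x) := fun z w => by
  simp only [elementaryOperator_apply, CStarModule.inner_op_smul_left,
    CStarModule.inner_op_smul_right, CStarModule.star_inner]

theorem norm_elementaryOperator_le (x y : E) : ‖elementaryOperator A x y‖ ≤ ‖y‖ * ‖x‖ :=
  LinearMap.mkContinuous_norm_le _ (by positivity) _

theorem elementaryOperator_mul {T T' : E →L[ℂ] E} (hT : IsInnerAdjoint A T T') (x y : E) :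
    elementaryOperator A x y * T = elementaryOperator A x (T' y) := by
  ext z
  rw [mul_apply_eq_comp, elementaryOperator_apply, elementaryOperator_apply, hT.symm]

theorem compactOperators_le_adjointableSubalgebra [CompleteSpace E] :
    compactOperators A E ≤ (adjointableSubalgebra A E).toSubmodule := by
  refine Submodule.topologicalClosure_minimal _ (Submodule.span_le.2 ?_)
    (isClosed_adjointableSubalgebra A E)
  rintro _ ⟨⟨x, y⟩, rfl⟩
  exact ⟨elementaryOperator A y x, isInnerAdjoint_elementaryOperator x y⟩

end AdjointableOperators

section FinitelyGenerated

open scoped WithCStarModule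

variable {A : Type*} [CStarAlgebra A] [PartialOrder A] [StarOrderedRing A]
variable {E : Type*} [NormedAddCommGroup E] [NormedSpace ℂ E] [Module A E] [CStarModule A E]

instance isBoundedSMul_of_cstarModule : IsBoundedSMul A E :=
  .of_norm_smul_le (norm_smul_le_cstarModule A)

variable {ι : Type*}

/-- The analysis operator `z ↦ (⟪g i, z⟫)ᵢ` of a finite family. -/
noncomputable def analysisOperator (g : ι → E) : E →L[ℂ] C⋆ᵐᵒᵈ(A, ι → A) :=
  (WithCStarModule.equivL ℂ).symm.toContinuousLinearMap ∘L
    ContinuousLinearMap.pi fun i => CStarModule.innerSL (g i)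

theorem analysisOperator_apply (g : ι → E) (z : E) (i : ι) :
    analysisOperator (A := A) g z i = inner A (g i) z := rfl

variable [Fintype ι] [IsScalarTower ℂ A E]

/-- The synthesis operator `a ↦ ∑ i, a i • g i` of a finite family. -/
noncomputable def synthesisOperator (g : ι → E) : C⋆ᵐᵒᵈ(A, ι → A) →L[ℂ] E :=
  (∑ i, (ContinuousLinearMap.toSpanSingleton A (g i)).restrictScalars ℂ ∘L
    ContinuousLinearMap.proj i) ∘L (WithCStarModule.equivL ℂ).toContinuousLinearMap

theorem synthesisOperator_apply (g : ι → E) (a : C⋆ᵐᵒᵈ(A, ι → A)) :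
    synthesisOperator g a = ∑ i, a i • g i := by
  simp [synthesisOperator]

theorem isInnerAdjoint_synthesisOperator (g : ι → E) :
    IsInnerAdjoint A (synthesisOperator (A := A) g) (analysisOperator g) := fun a z => by
  simp only [synthesisOperator_apply, CStarModule.inner_sum_left,
    CStarModule.inner_op_smul_left, WithCStarModule.pi_inner, analysisOperator_apply]
  rfl

/-- A submodule of a Hilbert module carries the restricted inner product. -/
noncomputable instance submoduleCStarModule (N : Submodule A E) : CStarModule A N where
  inner x y := inner A (x : E) (y : E)
  inner_add_right := CStarModule.inner_add_right
  inner_self_nonneg := CStarModule.inner_self_nonneg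
  inner_self := CStarModule.inner_self.trans Submodule.coe_eq_zero
  inner_op_smul_right := CStarModule.inner_op_smul_right
  inner_smul_right_complex := CStarModule.inner_smul_right_complex
  star_inner _ _ := CStarModule.star_inner _ _
  norm_eq_sqrt_norm_inner_self x := CStarModule.norm_eq_sqrt_norm_inner_self (x : E)

variable (A E) in
theorem exists_sum_inner_smul_eq [CompleteSpace E] [Module.Finite A E] :
    ∃ (n : ℕ) (g s : Fin n → E), ∀ z, ∑ i, inner A (g i) z • s i = z := by
  obtain ⟨n, g, hg⟩ := Module.Finite.exists_fin (R := A) (M := E)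
  have hsurj : Function.Surjective (synthesisOperator (A := A) g) := fun z => by
    obtain ⟨a, ha⟩ := (Submodule.mem_span_range_iff_exists_fun A).1
      (hg ▸ Submodule.mem_top (x := z))
    exact ⟨(WithCStarModule.equiv A _).symm a, (synthesisOperator_apply _ _).trans ha⟩
  have hadj := isInnerAdjoint_synthesisOperator (A := A) g
  obtain ⟨c, hc, hle⟩ := hadj.exists_norm_le_of_surjective hsurj
  obtain ⟨L, hL⟩ := hadj.symm.exists_leftInverse hc hle
  set e : Fin n → C⋆ᵐᵒᵈ(A, Fin n → A) := fun i =>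
    (WithCStarModule.linearEquiv A A _).symm (Pi.single i 1) with he
  refine ⟨n, g, fun i => L (e i), fun z => ?_⟩
  have hsum : analysisOperator (A := A) g z = ∑ i, inner A (g i) z • e i := by
    refine (WithCStarModule.linearEquiv A A (Fin n → A)).injective ?_
    simp only [map_sum, map_smul, he, LinearEquiv.apply_symm_apply]
    exact pi_eq_sum_univ' _
  calc ∑ i, inner A (g i) z • L (e i) = L (analysisOperator g z) := by
        rw [hsum, map_sum]; simp only [map_smul]
    _ = z := hL z

theorem exists_finiteRank_retraction [CompleteSpace E] {N : Submodule A E}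
    (hN : IsClosed (N : Set E)) (hfg : N.FG) :
    ∃ R : E →L[A] N, (∀ z : N, R z = z) ∧
      ∀ J : N →L[A] E, (J ∘L R).restrictScalars ℂ ∈ finiteRankOperators A E := by
  have : CompleteSpace N := hN.completeSpace_coe
  have : Module.Finite A N := Module.Finite.iff_fg.2 hfg
  obtain ⟨n, g, s, hgs⟩ := exists_sum_inner_smul_eq A N
  have hadj : IsInnerAdjoint A (synthesisOperator s ∘L analysisOperator fun i => (g i : E))
      (synthesisOperator (fun i => (g i : E)) ∘L analysisOperator s) :=
    (isInnerAdjoint_synthesisOperator s).comp (isInnerAdjoint_synthesisOperator _).symm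
  have hR (x : E) : hadj.toCLM x = ∑ i, inner A (g i : E) x • s i := synthesisOperator_apply _ _
  refine ⟨hadj.toCLM, fun z => (hR z).trans (hgs z), fun J => ?_⟩
  have hJ : (J ∘L hadj.toCLM).restrictScalars ℂ = ∑ i, elementaryOperator A (J (s i)) (g i) := by
    ext x
    simp only [ContinuousLinearMap.coe_restrictScalars', ContinuousLinearMap.comp_apply, hR,
      map_sum, map_smul, sum_apply, elementaryOperator_apply]
  rw [hJ]
  exact Submodule.sum_mem _ fun i _ => Submodule.subset_span ⟨(J (s i), g i), rfl⟩

end FinitelyGenerated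

section Forward

open Asymptotics

theorem isBoundedBelowOp_iff_isBigO {E : Type*} [NormedAddCommGroup E] [NormedSpace ℂ E]
    {D : E →L[ℂ] E} : IsBoundedBelowOp D ↔ (fun x => x) =O[⊤] D := by
  simp only [IsBoundedBelowOp, isBigO_iff'', eventually_top, gt_iff_lt]

variable {A : Type*} [CStarAlgebra A]
variable {E : Type*} [NormedAddCommGroup E] [NormedSpace ℂ E] [Module A E] [IsScalarTower ℂ A E]
variable {M N M₁ N₁ M₂ N₂ P : Submodule A E}

theorem isBigO_continuousLinearEquiv_comp {α : Type*} (e : M ≃L[A] N) (f : α → M) (l : Filter α) :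
    (fun x => (f x : E)) =O[l] fun x => (e (f x) : E) := by
  have h := ((e.symm : N →L[A] M).restrictScalars ℂ).isBigO_comp (fun x => e (f x)) l
  simpa using h.norm_norm

variable [CompleteSpace E]

theorem IsClosedDecomposition.isTopCompl (h : IsClosedDecomposition M N) :
    Submodule.IsTopCompl (M.restrictScalars ℂ) (N.restrictScalars ℂ) :=
  Submodule.isTopCompl_iff_isCompl_isClosed.2
    ⟨(Submodule.isCompl_restrictScalars_iff ℂ).2 h.2.2, h.1, h.2.1⟩

theorem IsDiagonalWithIso.isBoundedBelowOp_of_retraction {F D : E →L[ℂ] E}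
    (hF : IsDiagonalWithIso F M₁ N₁ M₂ N₂) (h₁ : IsClosedDecomposition M₁ N₁)
    (h₂ : IsClosedDecomposition M₂ N₂) {R : E →L[A] N₁} (hR : ∀ z : N₁, R z = z)
    (hP : P ≤ N₂) (e : N₁ ≃L[A] P) (hD : ∀ x, D x = F (x - R x) + e (R x)) :
    IsBoundedBelowOp D := by
  obtain ⟨⟨F₁, hF₁⟩, hFN⟩ := hF
  set p := Submodule.projectionL _ _ h₁.isTopCompl
  set q := Submodule.projectionL _ _ h₂.isTopCompl
  have hpM (x : E) : p x ∈ M₁ := Submodule.projectionL_apply_mem h₁.isTopCompl x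
  have hpN (x : E) : x - p x ∈ N₁ :=
    (Submodule.projectionL_apply_eq_zero_iff h₁.isTopCompl).1 (by
      rw [map_sub, (Submodule.projectionL_eq_self_iff h₁.isTopCompl _).2 (hpM x), sub_self])
  have hsub (x : E) : x - R x = p x - R (p x) := by
    have h : x - p x = R x - R (p x) := by
      rw [← AddSubgroupClass.coe_sub, ← map_sub, hR ⟨_, hpN x⟩]
    exact sub_eq_sub_iff_sub_eq_sub.2 h
  have hqD (x : E) : q (D x) = F (p x) := by
    have hM : F (p x) ∈ M₂ := hF₁ ⟨p x, hpM x⟩ ▸ (F₁ _).2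
    have hN : e (R x) - F (R (p x)) ∈ N₂ := N₂.sub_mem (hP (e _).2) (hFN _ (R _).2)
    have hDx : D x = F (p x) + (e (R x) - F (R (p x))) := by rw [hD, hsub, map_sub]; abel
    rw [hDx, map_add, (Submodule.projectionL_eq_self_iff h₂.isTopCompl _).2 hM,
      (Submodule.projectionL_apply_eq_zero_iff h₂.isTopCompl).2 hN, add_zero]
  have hpD : p =O[⊤] D :=
    calc p =O[⊤] fun x => F (p x) := by
          have h := isBigO_continuousLinearEquiv_comp F₁ (fun x => ⟨p x, hpM x⟩) ⊤
          simpa only [← hF₁] using h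
      _ =O[⊤] D := by simpa only [hqD] using q.isBigO_comp D ⊤
  have hsubD : (fun x => x - R x : E → E) =O[⊤] D := by
    have hR' := ((N₁.subtypeL ∘L R).restrictScalars ℂ).isBigO_comp p ⊤
    exact (hpD.sub (hR'.trans hpD)).congr_left fun x => (hsub x).symm
  have heD : (fun x => (e (R x) : E)) =O[⊤] D := by
    have h : (fun x => D x - F (x - R x)) =O[⊤] D :=
      (isBigO_refl _ _).sub ((F.isBigO_comp _ ⊤).trans hsubD)
    simpa only [hD, add_sub_cancel_left] using h
  have hRD : (fun x => (R x : E)) =O[⊤] D := (isBigO_continuousLinearEquiv_comp e R ⊤).trans heD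
  rw [isBoundedBelowOp_iff_isBigO]
  simpa only [sub_add_cancel] using hsubD.add hRD

variable [PartialOrder A] [StarOrderedRing A] [CStarModule A E]

theorem exists_isBoundedBelowOp_add_finiteRank {F : E →L[ℂ] E} (hF : F ∈ mPhiPlusMinusPrime A) :
    ∃ D K : E →L[ℂ] E, IsBoundedBelowOp D ∧ K ∈ finiteRankOperators A E ∧ F = D + K := by
  obtain ⟨⟨F', hF'⟩, M₁, N₁, M₂, N₂, h₁, h₂, hdiag, hfg, P, hPN, -, ⟨e⟩⟩ := hF
  obtain ⟨R, hR, hrank⟩ := exists_finiteRank_retraction h₁.2.1 hfg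
  set FA : E →L[A] E := IsInnerAdjoint.toCLM hF'
  set J : N₁ →L[A] E := FA ∘L N₁.subtypeL - P.subtypeL ∘L (e : N₁ →L[A] P)
  set K : E →L[ℂ] E := (J ∘L R).restrictScalars ℂ
  refine ⟨F - K, K, ?_, hrank _, (sub_add_cancel F K).symm⟩
  refine hdiag.isBoundedBelowOp_of_retraction h₁ h₂ hR hPN e fun x => ?_
  calc F x - (F (R x) - e (R x)) = F (x - R x) + e (R x) := by rw [map_sub]; abel

end Forward

section GeneralizedInverse

section Ring

variable {A E : Type*} [Ring A] [TopologicalSpace E] [AddCommGroup E] [Module A E]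

theorem exists_continuousLinearEquiv_of_leftInvOn {M M' : Submodule A E} {T S : E →L[A] E}
    (hT : ∀ x ∈ M, T x ∈ M') (hS : ∀ x ∈ M', S x ∈ M) (hST : ∀ x ∈ M, S (T x) = x)
    (hTS : ∀ x ∈ M', T (S x) = x) : ∃ e : M ≃L[A] M', ∀ x : M, (e x : E) = T x :=
  ⟨.equivOfInverse ((T ∘L M.subtypeL).codRestrict M' fun x => hT x x.2)
    ((S ∘L M'.subtypeL).codRestrict M fun x => hS x x.2)
    (fun x => Subtype.ext (hST x x.2)) (fun x => Subtype.ext (hTS x x.2)), fun _ => rfl⟩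

end Ring

variable {A : Type*} [CStarAlgebra A]
variable {E : Type*} [NormedAddCommGroup E] [Module A E]

theorem isEmbeddable_of_leftInvOn {N N' : Submodule A E} (hN : IsClosed (N : Set E))
    {T S : E →L[A] E} (hT : ∀ x ∈ N, T x ∈ N') (hST : ∀ x ∈ N, S (T x) = x) :
    IsEmbeddable N N' := by
  have himage (y : E) : y ∈ N.map (T : E →ₗ[A] E) ↔ S y ∈ N ∧ T (S y) = y := by
    constructor
    · rintro ⟨x, hx, rfl⟩
      simpa [hST x hx] using hx
    · rintro ⟨hy, hTS⟩
      exact ⟨S y, hy, hTS⟩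
  refine ⟨N.map (T : E →ₗ[A] E), ?_, ?_, ?_⟩
  · rintro _ ⟨x, hx, rfl⟩
    exact hT x hx
  · have hset : (N.map (T : E →ₗ[A] E) : Set E) = S ⁻¹' N ∩ {y | T (S y) = y} := Set.ext himage
    rw [hset]
    exact (hN.preimage S.continuous).inter
      (isClosed_eq (T.continuous.comp S.continuous) continuous_id)
  · obtain ⟨e, -⟩ := exists_continuousLinearEquiv_of_leftInvOn
      (fun x hx => Submodule.mem_map_of_mem (f := (T : E →ₗ[A] E)) hx)
      (fun y hy => ((himage y).1 hy).1) hST fun y hy => ((himage y).1 hy).2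
    exact ⟨e⟩

theorem isClosedDecomposition_of_isIdempotentElem {e : E →L[A] E} (he : IsIdempotentElem e) :
    IsClosedDecomposition (e : E →ₗ[A] E).range (e : E →ₗ[A] E).ker :=
  have h := ContinuousLinearMap.IsIdempotentElem.isTopCompl he
  ⟨h.isClosed, h.isClosed', h.isCompl⟩

variable [NormedSpace ℂ E] [IsScalarTower ℂ A E]

theorem isDiagonalWithIso_of_mul_mul_eq {F Q : E →L[A] E} (hQ : Q * F * Q = Q) :
    IsDiagonalWithIso (F.restrictScalars ℂ)
      ((Q * F : E →L[A] E) : E →ₗ[A] E).range ((Q * F : E →L[A] E) : E →ₗ[A] E).ker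
      ((F * Q : E →L[A] E) : E →ₗ[A] E).range ((F * Q : E →L[A] E) : E →ₗ[A] E).ker := by
  have hQ' (x : E) : Q (F (Q x)) = Q x := congrArg (· x) hQ
  constructor
  · obtain ⟨e, he⟩ := exists_continuousLinearEquiv_of_leftInvOn
      (M := ((Q * F : E →L[A] E) : E →ₗ[A] E).range)
      (M' := ((F * Q : E →L[A] E) : E →ₗ[A] E).range) (T := F) (S := Q)
      (by rintro _ ⟨x, rfl⟩; exact ⟨F x, rfl⟩) (by rintro _ ⟨x, rfl⟩; exact ⟨Q x, rfl⟩)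
      (by rintro _ ⟨x, rfl⟩; exact hQ' (F x))
      (by rintro _ ⟨x, rfl⟩; exact congrArg F (hQ' x))
    exact ⟨e, fun x => (he x).symm⟩
  · intro x hx
    exact (congrArg F hx).trans (map_zero F)

theorem exists_decomposition_of_mul_one_sub_eq {F D L p : E →L[A] E} (hL : L * D = 1)
    (hp : IsIdempotentElem p) (hfg : (p : E →ₗ[A] E).range.FG)
    (hFD : F * (1 - p) = D * (1 - p)) :
    ∃ M₁ N₁ M₂ N₂ : Submodule A E, IsClosedDecomposition M₁ N₁ ∧ IsClosedDecomposition M₂ N₂ ∧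
      IsDiagonalWithIso (F.restrictScalars ℂ) M₁ N₁ M₂ N₂ ∧ N₁.FG ∧ IsEmbeddable N₁ N₂ := by
  set Q := (1 - p) * L with hQ
  have hLF : L * F * (1 - p) = 1 - p := by rw [mul_assoc, hFD, ← mul_assoc, hL, one_mul]
  have hQF : Q * F * (1 - p) = 1 - p := by
    rw [hQ, mul_assoc, mul_assoc, ← mul_assoc L, hLF, hp.one_sub.eq]
  have hQFQ : Q * F * Q = Q := by rw [hQ, ← mul_assoc _ (1 - p), ← hQ, hQF]
  have hcompl : 1 - Q * F = (1 - Q * F) * p := by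
    rw [← sub_eq_zero, ← mul_one_sub, sub_mul, hQF, one_mul, sub_self]
  have hker {z : E} (hz : z ∈ ((Q * F : E →L[A] E) : E →ₗ[A] E).ker) :
      (1 - Q * F) (p z) = z := by
    rw [← mul_apply_eq_comp, ← hcompl, sub_apply, one_apply_eq_self]
    exact sub_eq_self.2 hz
  have h₁ := isClosedDecomposition_of_isIdempotentElem (show IsIdempotentElem (Q * F) by
    rw [IsIdempotentElem, ← mul_assoc, hQFQ])
  have h₂ := isClosedDecomposition_of_isIdempotentElem (show IsIdempotentElem (F * Q) by
    rw [IsIdempotentElem, mul_assoc, ← mul_assoc Q, hQFQ])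
  refine ⟨_, _, _, _, h₁, h₂, isDiagonalWithIso_of_mul_mul_eq hQFQ, ?_, ?_⟩
  · convert hfg.map ((1 - Q * F : E →L[A] E) : E →ₗ[A] E) using 1
    refine le_antisymm (fun z hz => ⟨p z, ⟨z, rfl⟩, hker hz⟩) ?_
    rintro _ ⟨z, -, rfl⟩
    change (Q * F * (1 - Q * F)) z = 0
    rw [mul_sub, mul_one, ← mul_assoc, hQFQ, sub_self, zero_apply]
  · refine isEmbeddable_of_leftInvOn h₁.2.1 (T := D * p) (S := (1 - Q * F) * L)
      (fun z _ => ?_) fun z hz => ?_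
    · change (F * Q * (D * p)) z = 0
      have h0 : F * Q * (D * p) = 0 := by
        rw [hQ, mul_assoc, mul_assoc, ← mul_assoc L, hL, one_mul, sub_mul, one_mul, hp.eq,
          sub_self, mul_zero]
      rw [h0, zero_apply]
    · change ((1 - Q * F) * L * (D * p)) z = z
      rw [mul_assoc, ← mul_assoc L, hL, one_mul]
      exact hker hz

end GeneralizedInverse

section ProjectionNet

theorem IsBoundedBelowOp.exists_forall_norm_lt {E : Type*} [NormedAddCommGroup E]
    [NormedSpace ℂ E] {D : E →L[ℂ] E} (hD : IsBoundedBelowOp D) :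
    ∃ ε > 0, ∀ T : E →L[ℂ] E, ‖T‖ < ε → IsBoundedBelowOp (D + T) := by
  obtain ⟨c, hc, h⟩ := hD
  refine ⟨c, hc, fun T hT => ⟨c - ‖T‖, sub_pos.2 hT, fun x => ?_⟩⟩
  calc (c - ‖T‖) * ‖x‖ = c * ‖x‖ - ‖T‖ * ‖x‖ := sub_mul _ _ _
    _ ≤ ‖D x‖ - ‖T x‖ := sub_le_sub (h x) (T.le_opNorm x)
    _ ≤ ‖(D + T) x‖ := norm_sub_le_norm_add _ _

variable {A : Type*} [CStarAlgebra A] [PartialOrder A]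
variable {E : Type*} [NormedAddCommGroup E] [NormedSpace ℂ E] [Module A E] [CStarModule A E]
variable {ι : Type*} {l : Filter ι} {p : ι → E →L[A] E}

/-- A net of orthogonal projections of a Hilbert module which have finitely generated ranges and
converge strongly to the identity. For `H_A` these are the projections onto finitely many
coordinates. -/
structure IsFGProjectionNet (l : Filter ι) (p : ι → E →L[A] E) : Prop where
  isIdempotentElem (i : ι) : IsIdempotentElem (p i)
  isInnerAdjoint (i : ι) : IsInnerAdjoint A (p i) (p i)
  fg_range (i : ι) : (p i : E →ₗ[A] E).range.FG
  tendsto (x : E) : Tendsto (fun i => p i x) l (𝓝 x)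

namespace IsFGProjectionNet

theorem isInnerAdjoint_one_sub (hp : IsFGProjectionNet l p) (i : ι) :
    IsInnerAdjoint A (1 - p i : E →L[A] E) (1 - p i : E →L[A] E) := fun x y => by
  simp only [sub_apply, one_apply_eq_self, CStarModule.inner_sub_left,
    CStarModule.inner_sub_right, hp.isInnerAdjoint i x y]

variable [StarOrderedRing A] [IsScalarTower ℂ A E]

theorem norm_one_sub_le (hp : IsFGProjectionNet l p) (i : ι) :
    ‖(1 - p i).restrictScalars ℂ‖ ≤ 1 :=
  ContinuousLinearMap.opNorm_le_bound _ zero_le_one fun x => by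
    rw [one_mul]
    exact (hp.isInnerAdjoint_one_sub i).norm_apply_le_of_idempotent
      (fun x => congrArg (· x) (hp.isIdempotentElem i).one_sub.eq) x

theorem tendsto_elementaryOperator_mul_one_sub (hp : IsFGProjectionNet l p) (x y : E) :
    Tendsto (fun i => elementaryOperator A x y * (1 - p i).restrictScalars ℂ) l (𝓝 0) := by
  have hy : Tendsto (fun i => ‖y - p i y‖ * ‖x‖) l (𝓝 0) := by
    simpa using ((tendsto_const_nhds (x := y)).sub (hp.tendsto y)).norm.mul_const ‖x‖
  refine squeeze_zero_norm (fun i => ?_) hy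
  rw [elementaryOperator_mul (T := (1 - p i).restrictScalars ℂ)
    (T' := (1 - p i).restrictScalars ℂ) (hp.isInnerAdjoint_one_sub i)]
  exact norm_elementaryOperator_le x _

theorem tendsto_mul_one_sub (hp : IsFGProjectionNet l p) {K : E →L[ℂ] E}
    (hK : K ∈ compactOperators A E) :
    Tendsto (fun i => K * (1 - p i).restrictScalars ℂ) l (𝓝 0) := by
  let S : Submodule ℂ (E →L[ℂ] E) :=
    { carrier := {T | Tendsto (fun i => T * (1 - p i).restrictScalars ℂ) l (𝓝 0)}
      add_mem' := fun hT hT' => by simpa [add_mul] using Tendsto.add hT hT'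
      zero_mem' := by simp [tendsto_const_nhds]
      smul_mem' := fun c T hT => by simpa using Tendsto.const_smul hT c }
  have hS : IsClosed (S : Set (E →L[ℂ] E)) := by
    have hlip (i : ι) :
        LipschitzWith 1 fun T : E →L[ℂ] E => T * (1 - p i).restrictScalars ℂ :=
      LipschitzWith.of_dist_le_mul fun T T' => by
        rw [dist_eq_norm, dist_eq_norm, ← sub_mul, NNReal.coe_one, mul_comm]
        exact (norm_mul_le _ _).trans (by gcongr; exact hp.norm_one_sub_le i)
    exact (LipschitzWith.uniformEquicontinuous _ 1 hlip).equicontinuous.isClosed_setOfPred_tendsto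
      (f := fun _ => 0) continuous_const
  refine Submodule.topologicalClosure_minimal _ (Submodule.span_le.2 ?_) hS hK
  rintro _ ⟨⟨x, y⟩, rfl⟩
  exact hp.tendsto_elementaryOperator_mul_one_sub x y

variable [CompleteSpace E] [l.NeBot]

theorem add_mem_mPhiPlusMinusPrime (hp : IsFGProjectionNet l p) {D K : E →L[ℂ] E}
    (hD : D ∈ adjointableOperators A) (hDb : IsBoundedBelowOp D) (hK : K ∈ compactOperators A E) :
    D + K ∈ mPhiPlusMinusPrime A := by
  obtain ⟨ε, hε, hpert⟩ := hDb.exists_forall_norm_lt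
  obtain ⟨i, hi⟩ := ((hp.tendsto_mul_one_sub hK).norm.eventually_lt_const
    (norm_zero.trans_lt hε)).exists
  have hKadj : K ∈ adjointableSubalgebra A E := compactOperators_le_adjointableSubalgebra hK
  have hF : D + K ∈ adjointableSubalgebra A E := add_mem hD hKadj
  have hD₁ : D + K * (1 - p i).restrictScalars ℂ ∈ adjointableSubalgebra A E :=
    add_mem hD (mul_mem hKadj ⟨(1 - p i).restrictScalars ℂ, hp.isInnerAdjoint_one_sub i⟩)
  obtain ⟨L, hL⟩ := exists_leftInverse_of_mem_adjointableOperators hD₁ (hpert _ hi)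
  refine ⟨hF, ?_⟩
  obtain ⟨F', hF'⟩ := hF
  obtain ⟨D', hD'⟩ := hD₁
  refine exists_decomposition_of_mul_one_sub_eq (F := IsInnerAdjoint.toCLM hF')
    (D := IsInnerAdjoint.toCLM hD') (L := L) (ContinuousLinearMap.ext hL)
    (hp.isIdempotentElem i) (hp.fg_range i) (ContinuousLinearMap.ext fun x => ?_)
  have hx : (1 - p i) ((1 - p i) x) = (1 - p i) x :=
    congrArg (· x) (hp.isIdempotentElem i).one_sub.eq
  exact congrArg (D ((1 - p i) x) + K ·) hx.symm

end IsFGProjectionNet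

theorem theorem5p10_general [StarOrderedRing A] [IsScalarTower ℂ A E] [CompleteSpace E] [l.NeBot]
    (hp : IsFGProjectionNet l p) (F : E →L[ℂ] E) :
    F ∈ mPhiPlusMinusPrime A ↔
      ∃ D K : E →L[ℂ] E, D ∈ adjointableOperators A ∧ IsBoundedBelowOp D ∧
        K ∈ compactOperators A E ∧ F = D + K := by
  constructor
  · intro hF
    obtain ⟨D, K, hDb, hK, rfl⟩ := exists_isBoundedBelowOp_add_finiteRank hF
    have hKc : K ∈ compactOperators A E := Submodule.le_topologicalClosure _ hK
    have hD : D + K - K ∈ adjointableSubalgebra A E :=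
      sub_mem hF.1 (compactOperators_le_adjointableSubalgebra hKc)
    exact ⟨D, K, add_sub_cancel_right D K ▸ hD, hDb, hKc, rfl⟩
  · rintro ⟨D, K, hD, hDb, hK, rfl⟩
    exact hp.add_mem_mPhiPlusMinusPrime hD hDb hK

end ProjectionNet

namespace StdModule

variable {A : Type*} [CStarAlgebra A] [PartialOrder A] [StarOrderedRing A]

/-- The linear map that sends an arbitrary sequence to the finitely supported sequence which agrees
with it on `s`; on `H_A` it is the projection onto the coordinates in `s`. -/
noncomputable def truncate (s : Finset ℕ) : (ℕ → A) →ₗ[A] StdModule A where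
  toFun v := ⟨fun k => if k ∈ s then v k else 0,
    summable_of_ne_finset_zero (s := s) fun k hk => by simp [hk]⟩
  map_add' v w := ext fun k =>
    (if_congr Iff.rfl rfl (add_zero 0).symm).trans (ite_add_ite (k ∈ s) _ _ _ _).symm
  map_smul' a v := ext fun k => by
    rw [RingHom.id_apply]
    exact (mul_ite_zero (k ∈ s) a (v k)).symm

theorem coord_truncate (s : Finset ℕ) (v : ℕ → A) (k : ℕ) :
    (truncate s v).coord k = if k ∈ s then v k else 0 := rfl

theorem truncate_coord_truncate (s : Finset ℕ) (v : ℕ → A) :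
    truncate s (truncate s v).coord = truncate s v := by
  ext k
  simp only [coord_truncate]
  split_ifs <;> rfl

theorem inner_truncate (s : Finset ℕ) (v : ℕ → A) (x : StdModule A) :
    inner A (truncate s v) x = ∑ k ∈ s, x.coord k * star (v k) := by
  rw [inner_def, tsum_eq_sum (s := s) fun k hk => by simp [coord_truncate, hk]]
  exact Finset.sum_congr rfl fun k hk => by simp [coord_truncate, hk]

theorem isInnerAdjoint_truncate_coord (s : Finset ℕ) :
    IsInnerAdjoint A (fun x : StdModule A => truncate s x.coord) fun x => truncate s x.coord :=
  fun x y => by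
    rw [inner_truncate, ← CStarModule.star_inner, inner_truncate, star_sum]
    simp only [star_mul, star_star]

theorem norm_truncate_coord_le (s : Finset ℕ) (x : StdModule A) : ‖truncate s x.coord‖ ≤ ‖x‖ :=
  (isInnerAdjoint_truncate_coord s).norm_apply_le_of_idempotent
    (fun x => truncate_coord_truncate s x.coord) x

theorem norm_truncate_sq (s : Finset ℕ) (v : ℕ → A) :
    ‖truncate s v‖ ^ 2 = ‖∑ k ∈ s, v k * star (v k)‖ := by
  rw [CStarModule.norm_sq_eq A, inner_truncate]
  exact congrArg _ (Finset.sum_congr rfl fun k hk => by simp [coord_truncate, hk])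

theorem tendsto_truncate_coord (x : StdModule A) :
    Tendsto (fun s => truncate s x.coord) atTop (𝓝 x) := by
  have hsq (s : Finset ℕ) : ‖x - truncate s x.coord‖ ^ 2 =
      ‖inner A x x - ∑ k ∈ s, x.coord k * star (x.coord k)‖ := by
    rw [← inner_truncate]
    exact (isInnerAdjoint_truncate_coord s).norm_sub_apply_sq_of_idempotent
      (fun x => truncate_coord_truncate s x.coord) x
  have hlim : Tendsto (fun s : Finset ℕ => ‖x - truncate s x.coord‖ ^ 2) atTop (𝓝 0) := by
    simp only [hsq]
    exact (tendsto_iff_norm_sub_tendsto_zero.1 x.summable_self.hasSum).congr fun s =>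
      norm_sub_rev _ _
  rw [tendsto_iff_norm_sub_tendsto_zero]
  simpa [norm_sub_rev] using hlim.sqrt

variable (A) in
/-- The `k`-th element of the standard basis of `H_A`. -/
noncomputable def basisVector (k : ℕ) : StdModule A := truncate {k} 1

theorem inner_basisVector (k : ℕ) (x : StdModule A) : inner A (basisVector A k) x = x.coord k := by
  simp [basisVector, inner_truncate]

theorem truncate_eq_sum (s : Finset ℕ) (v : ℕ → A) :
    truncate s v = ∑ k ∈ s, v k • basisVector A k := by
  refine eq_of_forall_inner_eq (A := A) fun z => ?_
  simp [inner_truncate, inner_basisVector]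

theorem continuous_truncate (s : Finset ℕ) : Continuous (truncate (A := A) s) := by
  rw [funext (truncate_eq_sum s)]
  fun_prop

theorem uniformContinuous_coord (k : ℕ) :
    UniformContinuous fun x : StdModule A => x.coord k :=
  (funext (inner_basisVector k) : ⇑(CStarModule.innerSL (A := A) (basisVector A k)) = _) ▸
    ContinuousLinearMap.uniformContinuous _

theorem summable_mul_star_iff {v : ℕ → A} :
    (Summable fun k => v k * star (v k)) ↔
      ∀ ε > 0, ∃ s : Finset ℕ, ∀ t, Disjoint t s → ‖truncate t v‖ < ε := by
  simp only [summable_iff_vanishing_norm, ← norm_truncate_sq]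
  constructor
  · intro h ε hε
    obtain ⟨s, hs⟩ := h (ε ^ 2) (pow_pos hε 2)
    exact ⟨s, fun t ht => lt_of_pow_lt_pow_left₀ 2 hε.le (hs t ht)⟩
  · intro h ε hε
    obtain ⟨s, hs⟩ := h √ε (Real.sqrt_pos.2 hε)
    exact ⟨s, fun t ht => (Real.lt_sqrt (norm_nonneg _)).1 (hs t ht)⟩

theorem exists_coord_eq_of_forall_exists_norm_truncate_le {v : ℕ → A}
    (h : ∀ ε > 0, ∃ x : StdModule A, ∀ s, ‖truncate s (x.coord - v)‖ ≤ ε) :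
    ∃ x : StdModule A, x.coord = v := by
  refine ⟨⟨v, summable_mul_star_iff.2 fun ε hε => ?_⟩, rfl⟩
  obtain ⟨x, hx⟩ := h (ε / 2) (half_pos hε)
  obtain ⟨s, hs⟩ := summable_mul_star_iff.1 x.summable_self (ε / 2) (half_pos hε)
  refine ⟨s, fun t ht => ?_⟩
  calc ‖truncate t v‖ = ‖truncate t x.coord - truncate t (x.coord - v)‖ := by
        rw [← map_sub, sub_sub_cancel]
    _ ≤ ‖truncate t x.coord‖ + ‖truncate t (x.coord - v)‖ := norm_sub_le _ _
    _ < ε / 2 + ε / 2 := add_lt_add_of_lt_of_le (hs t ht) (hx t)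
    _ = ε := add_halves ε

theorem norm_truncate_sub_le_of_tendsto {ι : Type*} {l : Filter ι} [l.NeBot] {u : ι → StdModule A}
    {v : ℕ → A} {x : StdModule A} {C : ℝ} (hv : Tendsto (fun i => (u i).coord) l (𝓝 v))
    (hC : ∀ᶠ i in l, ‖x - u i‖ ≤ C) (s : Finset ℕ) : ‖truncate s (x.coord - v)‖ ≤ C := by
  have hlim : Tendsto (fun i => truncate s (x - u i).coord) l (𝓝 (truncate s (x.coord - v))) :=
    ((continuous_truncate s).tendsto _).comp (hv.const_sub x.coord)
  exact le_of_tendsto hlim.norm (hC.mono fun i hi => (norm_truncate_coord_le s _).trans hi)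

instance : CompleteSpace (StdModule A) := by
  refine Metric.complete_of_cauchySeq_tendsto fun u hu => ?_
  choose v hv using fun k =>
    cauchySeq_tendsto_of_complete ((uniformContinuous_coord k).comp_cauchySeq hu)
  have happrox (ε : ℝ) (hε : 0 < ε) :
      ∃ N, ∀ m ≥ N, ∀ s, ‖truncate s ((u m).coord - v)‖ ≤ ε := by
    obtain ⟨N, hN⟩ := Metric.cauchySeq_iff.1 hu ε hε
    refine ⟨N, fun m hm => norm_truncate_sub_le_of_tendsto (tendsto_pi_nhds.2 hv) ?_⟩
    filter_upwards [eventually_ge_atTop N] with n hn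
    exact (dist_eq_norm (u m) (u n) ▸ hN m hm n hn).le
  obtain ⟨x, rfl⟩ := exists_coord_eq_of_forall_exists_norm_truncate_le fun ε hε =>
    (happrox ε hε).elim fun N hN => ⟨u N, hN N le_rfl⟩
  refine ⟨x, Metric.nhds_basis_closedBall.tendsto_right_iff.2 fun ε hε => ?_⟩
  obtain ⟨N, hN⟩ := happrox ε hε
  filter_upwards [eventually_ge_atTop N] with m hm
  rw [mem_closedBall_iff_norm]
  exact le_of_tendsto (tendsto_truncate_coord _).norm (.of_forall (hN m hm))

/-- The projection of `H_A` onto the coordinates in `s`. -/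
noncomputable def coordProj (s : Finset ℕ) : StdModule A →L[A] StdModule A where
  toFun x := truncate s x.coord
  map_add' x y := map_add (truncate s) x.coord y.coord
  map_smul' a x := map_smul (truncate s) a x.coord
  cont := (continuous_truncate s).comp
    (continuous_pi fun k => (uniformContinuous_coord k).continuous)

theorem range_truncate (s : Finset ℕ) :
    (truncate (A := A) s).range = Submodule.span A (basisVector A '' s) := by
  ext x
  simp only [LinearMap.mem_range, truncate_eq_sum s,
    Submodule.mem_span_image_finset_iff_exists_fun']

theorem range_coordProj (s : Finset ℕ) :
    (coordProj (A := A) s : StdModule A →ₗ[A] StdModule A).range = (truncate s).range := by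
  refine le_antisymm (fun _ ⟨x, hx⟩ => ⟨x.coord, hx⟩) ?_
  rintro _ ⟨v, rfl⟩
  exact ⟨truncate s v, truncate_coord_truncate s v⟩

theorem isFGProjectionNet_coordProj : IsFGProjectionNet atTop (coordProj (A := A)) where
  isIdempotentElem s := ContinuousLinearMap.ext fun x => truncate_coord_truncate s x.coord
  isInnerAdjoint := isInnerAdjoint_truncate_coord
  fg_range s := by
    rw [range_coordProj, range_truncate]
    exact Submodule.fg_span (s.finite_toSet.image _)
  tendsto := tendsto_truncate_coord

end StdModule

theorem theorem5p10 {A : Type*} [CStarAlgebra A] [PartialOrder A] [StarOrderedRing A]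
    (F : StdModule A →L[ℂ] StdModule A) (hF : F ∈ adjointableOperators A) :
    F ∈ mPhiPlusMinusPrime A ↔
      ∃ D K : StdModule A →L[ℂ] StdModule A,
        D ∈ adjointableOperators A ∧ IsBoundedBelowOp D ∧
          K ∈ compactOperators A (StdModule A) ∧ F = D + K :=
  theorem5p10_general StdModule.isFGProjectionNet_coordProj F
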